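/- Let $\ell\ge 1$ and let $P_1,\dots,P_\ell$ be finite groups each of whose automorphism groups $\operatorname{Aut}(P_i)$ is abelian. Let $L_1$ and $L_2$ be finite groups of the same order, and suppose that there are normal subgroups $N_1\trianglelefteq L_1$ and $N_2\trianglelefteq L_2$ with $N_1\cong N_2$ such that, for each $\delta\in\{1,2\}$, $$L_\delta/N_\delta\cong P_1\rtimes_{\phi_{1;\delta}}\bigl(P_2\rtimes_{\phi_{2;\delta}}\bigl(\cdots(P_{\ell-1}\rtimes_{\phi_{\ell-1;\delta}}P_\ell)\cdots\bigr)\bigr)$$ for some homomorphisms $$\phi_{i;\delta}\colon P_{i+1}\rtimes_{\phi_{i+1;\delta}}\bigl(\cdots(P_{\ell-1}\rtimes_{\phi_{\ell-1;\delta}}P_\ell)\cdots\bigr)\to\operatorname{Aut}(P_i)\qquad(1\le i\le\ell-1),$$ where the homomorphisms for $\delta=1$ and $\delta=2$ may differ (for $\ell=1$ the condition reads $L_\delta/N_\delta\cong P_1$). Then $L_1$ and $L_2$ are compatible, that is, there exists a finite group $G$ with normal subgroups $M_1,M_2\trianglelefteq G$ such that $M_1\cong M_2$, $L_1\cong G/M_1$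 and $L_2\cong G/M_2$. -/

import Mathlib

universe u v w

/-- Two finite groups `L₁`, `L₂` are compatible if there is a finite group `G` with isomorphic
normal subgroups `M₁ ≅ M₂` such that `L₁ ≅ G / M₁` and `L₂ ≅ G / M₂`.
(Every finite group has an isomorphic copy in `Type`, so letting `G` range over `Type` loses
nothing.) -/
def Compatible (L₁ : Type u) (L₂ : Type v) [Group L₁] [Group L₂] : Prop :=
  ∃ (G : Type) (_ : Group G) (_ : Finite G) (M₁ M₂ : Subgroup G) (_ : M₁.Normal) (_ : M₂.Normal),
    Nonempty (M₁ ≃* M₂) ∧ Nonempty (L₁ ≃* G ⧸ M₁) ∧ Nonempty (L₂ ≃* G ⧸ M₂)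

/-- `IsIteratedSemidirectProduct n P H` says that the group `H` is isomorphic to
`P 0 ⋊ (P 1 ⋊ (⋯ (P (n - 1) ⋊ P n)⋯))` for some choice of the actions by automorphisms
occurring in it. There are `n + 1` factors; for `n = 0` it says that `H` is isomorphic to `P 0`.
In the recursive clause `Q` is isomorphic to the inner product `P 1 ⋊ (⋯ ⋊ P (n + 1))`; as it
embeds in `H`, it may be taken in the universe of `H`. -/
def IsIteratedSemidirectProduct : (n : ℕ) → (P : Fin (n + 1) → Type w) → [∀ i, Group (P i)] →
    (H : Type u) → [Group H] → Prop
  | 0, P, _, H, _ => Nonempty (H ≃* P 0)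
  | n + 1, P, _, H, _ =>
      ∃ (Q : Type u) (_ : Group Q) (φ : Q →* MulAut (P 0)),
        IsIteratedSemidirectProduct n (fun i : Fin (n + 1) => P i.succ) Q ∧
          Nonempty (H ≃* P 0 ⋊[φ] Q)

/-! The factors are stripped off one at a time, carrying subgroups `R₁ ≅ R₂` of the kernels that
become the final kernels. With `A = Aut P`, `twistedCover` attaches to `(p, q)` lifts, for every `σ
∈ A`, of `(σ⁻¹ p, q)` to `L₁` and of `(σ⁻¹ p, 1)` to `L₂`. The second family ignores `q`; permuting
its indices by `φ₁ q` supplies the missing action. Over `q = 1` the two families play the same role,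
so the covers of `L₁` and `L₂` have isomorphic kernels over `Q₁` and `Q₂` (`kerEquiv`), and the
preimages of `R₁` and `R₂` stay isomorphic (`nonempty_comap_eval_equiv`). With one factor left, a
fibre product finishes. -/

/-- A finite cover of `L₁` built from a family of twisted copies of `L₁` and `L₂`, indexed by
`MulAut P`: it surjects onto `L₁` by evaluating the first component at `1`, and the kernel of its
projection to `Q₁` depends symmetrically on `f₁` and `f₂`. -/
def twistedCover {P : Type*} {Q₁ : Type*} {Q₂ : Type*} {L₁ : Type*} {L₂ : Type*} [Group P]
    [Group Q₁] [Group Q₂] [Group L₁] [Group L₂] {φ₁ : Q₁ →* MulAut P} {φ₂ : Q₂ →* MulAut P}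
    (hP : ∀ σ τ : MulAut P, σ * τ = τ * σ)
    (f₁ : L₁ →* P ⋊[φ₁] Q₁) (f₂ : L₂ →* P ⋊[φ₂] Q₂) :
    Subgroup ((MulAut P → L₁) × ((MulAut P → L₂) ⋊[mulAutArrow] MulAut P) × (P ⋊[φ₁] Q₁)) where
  carrier := {g | (∀ σ, f₁ (g.1 σ) = ⟨σ⁻¹ g.2.2.left, g.2.2.right⟩) ∧
    (∀ σ, f₂ (g.2.1.left σ) = SemidirectProduct.inl (σ⁻¹ g.2.2.left)) ∧
    g.2.1.right = φ₁ g.2.2.right}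
  one_mem' := by
    refine ⟨fun σ => ?_, fun σ => ?_, ?_⟩
    · simp only [Prod.fst_one, Pi.one_apply, map_one]
      ext <;> simp
    · simp
    · simp
  mul_mem' := by
    rintro ⟨x, w, h⟩ ⟨x', w', h'⟩ ⟨h1, h2, h3⟩ ⟨h1', h2', h3'⟩
    dsimp only at h1 h2 h3 h1' h2' h3'
    refine ⟨fun σ => ?_, fun σ => ?_, ?_⟩
    -- Commutativity of `Aut P` makes `(p, q) ↦ (σ⁻¹ p, q)` an endomorphism of `P ⋊ Q₁`.
    · have hc : ∀ p, φ₁ h.right (σ⁻¹ p) = σ⁻¹ (φ₁ h.right p) := fun p => by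
        rw [← MulAut.mul_apply, hP, MulAut.mul_apply]
      simp only [Prod.mk_mul_mk, Pi.mul_apply, map_mul, h1, h1']
      exact SemidirectProduct.ext (by simpa using hc h'.left) rfl
    -- The index shift turns `σ⁻¹` into `σ⁻¹ * φ₁ h.right`, matching the twisted product in `P ⋊
    -- Q₁`; no commutativity is needed here.
    · have hw : (w * w').left σ = w.left σ * w'.left (w.right⁻¹ * σ) := rfl
      simp only [Prod.mk_mul_mk, hw, map_mul, h2, h2', h3, SemidirectProduct.mul_left]
      simp
    · simp [h3, h3']
  inv_mem' := by
    rintro ⟨x, w, h⟩ ⟨h1, h2, h3⟩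
    dsimp only at h1 h2 h3
    refine ⟨fun σ => ?_, fun σ => ?_, ?_⟩
    · have hc : ∀ p, (φ₁ h.right)⁻¹ (σ⁻¹ p) = σ⁻¹ ((φ₁ h.right)⁻¹ p) := fun p => by
        rw [← MulAut.mul_apply, hP, MulAut.mul_apply]
      simp only [Prod.inv_mk, Pi.inv_apply, map_inv, h1]
      ext
      · simpa using hc h.left⁻¹
      · simp
    · have hw : (w⁻¹).left σ = (w.left (w.right * σ))⁻¹ := by
        change (w.left ((w.right⁻¹)⁻¹ * σ))⁻¹ = _
        rw [inv_inv]
      simp only [Prod.inv_mk, hw, map_inv, h2, h3, SemidirectProduct.inv_left]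
      simp
    · simp [h3]

namespace twistedCover

variable {P : Type*} {Q₁ : Type*} {Q₂ : Type*} {L₁ : Type*} {L₂ : Type*} [Group P]
    [Group Q₁] [Group Q₂] [Group L₁] [Group L₂] {φ₁ : Q₁ →* MulAut P} {φ₂ : Q₂ →* MulAut P}
    (hP : ∀ σ τ : MulAut P, σ * τ = τ * σ)
    (f₁ : L₁ →* P ⋊[φ₁] Q₁) (f₂ : L₂ →* P ⋊[φ₂] Q₂)

/-- Evaluation of the first component at `1`. -/
def eval : twistedCover hP f₁ f₂ →* L₁ where
  toFun g := g.1.1 1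
  map_one' := rfl
  map_mul' _ _ := rfl

/-- The projection of the cover to `Q₁`. -/
def proj : twistedCover hP f₁ f₂ →* Q₁ where
  toFun g := g.1.2.2.right
  map_one' := rfl
  map_mul' _ _ := rfl

theorem exists_eval_eq (hf₁ : Function.Surjective f₁) (hf₂ : Function.Surjective f₂) (h : P ⋊[φ₁] Q₁)
    (l : L₁) (hl : f₁ l = h) :
    ∃ g, eval hP f₁ f₂ g = l ∧ proj hP f₁ f₂ g = h.right := by
  classical
  choose s₁ hs₁ using hf₁
  choose s₂ hs₂ using hf₂
  -- Any lifts will do, except that the one at index `1` must be `l`.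
  refine ⟨⟨(Function.update (fun σ => s₁ ⟨σ⁻¹ h.left, h.right⟩) 1 l,
    ⟨fun σ => s₂ (SemidirectProduct.inl (σ⁻¹ h.left)), φ₁ h.right⟩, h), fun σ => ?_, fun σ => ?_,
    rfl⟩, ?_, rfl⟩
  · by_cases hσ : σ = 1
    · subst hσ
      simp [hl]
    · simp [hσ, hs₁]
  · simp [hs₂]
  · simp [eval]

theorem eval_surjective (hf₁ : Function.Surjective f₁) (hf₂ : Function.Surjective f₂) :
    Function.Surjective (eval hP f₁ f₂) := fun l =>
  let ⟨g, hg, _⟩ := exists_eval_eq hP f₁ f₂ hf₁ hf₂ _ l rfl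
  ⟨g, hg⟩

theorem proj_surjective (hf₁ : Function.Surjective f₁) (hf₂ : Function.Surjective f₂) :
    Function.Surjective (proj hP f₁ f₂) := fun q =>
  let ⟨l, hl⟩ := hf₁ (SemidirectProduct.inr q)
  let ⟨g, _, hg⟩ := exists_eval_eq hP f₁ f₂ hf₁ hf₂ _ l hl
  ⟨g, hg⟩

theorem comap_eval_le_ker_proj {R : Subgroup L₁} (hR : R ≤ f₁.ker) :
    R.comap (eval hP f₁ f₂) ≤ (proj hP f₁ f₂).ker := fun g hg => by
  have h : f₁ (g.1.1 1) = 1 := hR hg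
  rw [g.2.1 1] at h
  exact congrArg SemidirectProduct.right h

/-- Exchanging the two families in the kernel of the projection. -/
def kerSwap : (proj hP f₁ f₂).ker →* (proj hP f₂ f₁).ker where
  toFun g := ⟨⟨(g.1.1.2.1.left, ⟨g.1.1.1, 1⟩, SemidirectProduct.inl g.1.1.2.2.left), by
    have hg : g.1.1.2.2.right = 1 := g.2
    refine ⟨fun σ => ?_, fun σ => ?_, ?_⟩
    · rw [g.1.2.2.1 σ]
      rfl
    · rw [g.1.2.1 σ, hg]
      rfl
    · simp⟩, rfl⟩
  map_one' := rfl
  map_mul' g g' := by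
    have hg : g.1.1.2.2.right = 1 := g.2
    -- The shift is trivial on the kernel, so both families multiply pointwise.
    have hw : g.1.1.2.1.right = 1 := by rw [g.1.2.2.2, hg, map_one]
    refine Subtype.ext (Subtype.ext (Prod.ext ?_ (Prod.ext ?_ ?_)))
    · simp [hw]
    · ext <;> simp
    · ext <;> simp [hg]

theorem kerSwap_kerSwap (g : (proj hP f₁ f₂).ker) :
    kerSwap hP f₂ f₁ (kerSwap hP f₁ f₂ g) = g := by
  have hg : g.1.1.2.2.right = 1 := g.2
  have hw : g.1.1.2.1.right = 1 := by rw [g.1.2.2.2, hg, map_one]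
  refine Subtype.ext (Subtype.ext (Prod.ext rfl (Prod.ext ?_ ?_)))
  · exact SemidirectProduct.ext rfl hw.symm
  · exact SemidirectProduct.ext rfl hg.symm

/-- The kernel of the projection is symmetric in the two families. -/
def kerEquiv : (proj hP f₁ f₂).ker ≃* (proj hP f₂ f₁).ker where
  __ := kerSwap hP f₁ f₂
  invFun := kerSwap hP f₂ f₁
  left_inv := kerSwap_kerSwap hP f₁ f₂
  right_inv := kerSwap_kerSwap hP f₂ f₁

open Classical in
/-- The preimage in the cover of a subgroup `R` of `ker f₁` is a direct product. -/
def comapEvalEquiv {R : Subgroup L₁} (hR : R ≤ f₁.ker) :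
    R.comap (eval hP f₁ f₂) ≃*
      (∀ σ : MulAut P, (if σ = 1 then R else f₁.ker : Subgroup L₁)) × (MulAut P → f₂.ker) := by
  have hone : ∀ g ∈ R.comap (eval hP f₁ f₂), g.1.2.2 = 1 := fun g hg => by
    have h : f₁ (g.1.1 1) = 1 := hR hg
    rw [g.2.1 1] at h
    exact SemidirectProduct.ext (by simpa using congrArg SemidirectProduct.left h)
      (congrArg SemidirectProduct.right h)
  have hw : ∀ g ∈ R.comap (eval hP f₁ f₂), g.1.2.1.right = 1 := fun g hg => by
    rw [g.2.2.2, hone g hg]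
    simp
  exact
  { toFun := fun g => (fun σ => ⟨g.1.1.1 σ, by
        split_ifs with hσ
        · rw [hσ]
          exact g.2
        · rw [MonoidHom.mem_ker, g.1.2.1 σ, hone g.1 g.2]
          ext <;> simp⟩,
      fun σ => ⟨g.1.1.2.1.left σ, by
        rw [MonoidHom.mem_ker, g.1.2.2.1 σ, hone g.1 g.2]
        simp⟩)
    invFun := fun z => ⟨⟨(fun σ => z.1 σ, ⟨fun σ => z.2 σ, 1⟩, 1), by
        refine ⟨fun σ => ?_, fun σ => ?_, ?_⟩
        · have h := (z.1 σ).2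
          have h' : f₁ (z.1 σ : L₁) = 1 := by
            split_ifs at h
            · exact hR h
            · exact h
          change f₁ (z.1 σ : L₁) = _
          rw [h']
          ext <;> simp
        · have h : f₂ (z.2 σ : L₂) = 1 := (z.2 σ).2
          simp [h]
        · simp⟩, by
        exact (if_pos rfl : (if (1 : MulAut P) = 1 then R else f₁.ker) = R).le (z.1 1).2⟩
    left_inv := fun g => Subtype.ext (Subtype.ext (Prod.ext rfl (Prod.ext
      (SemidirectProduct.ext rfl (hw g.1 g.2).symm) (hone g.1 g.2).symm)))
    right_inv := fun z => rfl
    map_mul' := fun g g' => by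
      refine Prod.ext rfl (funext fun σ => Subtype.ext ?_)
      simp [hw g.1 g.2] }

/-- Index `1` contributes `R₁` or `R₂`; every other factor is one of the two isomorphic kernels, so
the products match index by index. -/
theorem nonempty_comap_eval_equiv {R₁ : Subgroup L₁} {R₂ : Subgroup L₂} (hR₁ : R₁ ≤ f₁.ker)
    (hR₂ : R₂ ≤ f₂.ker) (eN : f₁.ker ≃* f₂.ker) (eR : R₁ ≃* R₂) :
    Nonempty (R₁.comap (eval hP f₁ f₂) ≃* R₂.comap (eval hP f₂ f₁)) := by
  classical
  have e : ∀ σ : MulAut P, Nonempty ((if σ = 1 then R₁ else f₁.ker : Subgroup L₁) ≃*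
      (if σ = 1 then R₂ else f₂.ker : Subgroup L₂)) := fun σ => by
    by_cases hσ : σ = 1
    · rw [if_pos hσ, if_pos hσ]
      exact ⟨eR⟩
    · rw [if_neg hσ, if_neg hσ]
      exact ⟨eN⟩
  exact ⟨(comapEvalEquiv hP f₁ f₂ hR₁).trans
    ((MulEquiv.prodCongr (MulEquiv.piCongrRight fun σ => (e σ).some)
      (MulEquiv.piCongrRight fun _ => eN.symm)).trans (comapEvalEquiv hP f₂ f₁ hR₂).symm)⟩

end twistedCover

/-! ### Fibre products and the induction on the number of factors -/

/-- In the fibre product of `f₁` and `f₂`, the preimages of isomorphic subgroups of the kernels are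
isomorphic, provided that the kernels are. -/
theorem nonempty_comap_fiberProduct_equiv {L₁ : Type*} {L₂ : Type*} {P : Type*} [Group L₁]
    [Group L₂] [Group P] (f₁ : L₁ →* P) (f₂ : L₂ →* P) {R₁ : Subgroup L₁} {R₂ : Subgroup L₂}
    (hR₁ : R₁ ≤ f₁.ker) (hR₂ : R₂ ≤ f₂.ker) (eN : f₁.ker ≃* f₂.ker) (eR : R₁ ≃* R₂)
    (G : Subgroup (L₁ × L₂)) (hG : ∀ g, g ∈ G ↔ f₁ g.1 = f₂ g.2) :
    Nonempty (R₁.comap ((MonoidHom.fst L₁ L₂).comp G.subtype) ≃*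
      R₂.comap ((MonoidHom.snd L₁ L₂).comp G.subtype)) := by
  let e₁ : R₁.comap ((MonoidHom.fst L₁ L₂).comp G.subtype) ≃* R₁ × f₂.ker :=
    { toFun := fun g => (⟨g.1.1.1, g.2⟩, ⟨g.1.1.2, ((hG _).1 g.1.2).symm.trans (hR₁ g.2)⟩)
      invFun := fun z => ⟨⟨(z.1, z.2), (hG _).2 ((hR₁ z.1.2).trans z.2.2.symm)⟩, z.1.2⟩
      left_inv := fun _ => rfl
      right_inv := fun _ => rfl
      map_mul' := fun _ _ => rfl }
  let e₂ : R₂.comap ((MonoidHom.snd L₁ L₂).comp G.subtype) ≃* R₂ × f₁.ker :=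
    { toFun := fun g => (⟨g.1.1.2, g.2⟩, ⟨g.1.1.1, ((hG _).1 g.1.2).trans (hR₂ g.2)⟩)
      invFun := fun z => ⟨⟨(z.2, z.1), (hG _).2 (z.2.2.trans (hR₂ z.1.2).symm)⟩, z.1.2⟩
      left_inv := fun _ => rfl
      right_inv := fun _ => rfl
      map_mul' := fun _ _ => rfl }
  exact ⟨e₁.trans ((MulEquiv.prodCongr eR eN.symm).trans e₂.symm)⟩

theorem ker_mulEquiv_comp {L : Type*} {H : Type*} {H' : Type*} [Group L] [Group H] [Group H']
    (f : L →* H) (e : H ≃* H') : (e.toMonoidHom.comp f).ker = f.ker := by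
  ext x
  simp [MonoidHom.mem_ker]

/-- Two finite extensions of iterated semidirect products by isomorphic kernels have a common finite
cover in which the preimages of given isomorphic subgroups of the kernels are isomorphic. -/
theorem exists_common_cover (n : ℕ) : ∀ (P : Fin (n + 1) → Type w) [∀ i, Group (P i)]
    [∀ i, Finite (P i)] (_ : ∀ i, ∀ σ τ : MulAut (P i), σ * τ = τ * σ)
    {H₁ : Type u} {H₂ : Type v} [Group H₁] [Group H₂] [Finite H₁] [Finite H₂]
    (_ : IsIteratedSemidirectProduct n P H₁) (_ : IsIteratedSemidirectProduct n P H₂)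
    {L₁ L₂ : Type (max u v w)} [Group L₁] [Group L₂] [Finite L₁] [Finite L₂]
    (f₁ : L₁ →* H₁) (f₂ : L₂ →* H₂) (_ : Function.Surjective f₁) (_ : Function.Surjective f₂)
    (R₁ : Subgroup L₁) (R₂ : Subgroup L₂) (_ : R₁ ≤ f₁.ker) (_ : R₂ ≤ f₂.ker)
    (_ : f₁.ker ≃* f₂.ker) (_ : R₁ ≃* R₂),
    ∃ (G : Type (max u v w)) (_ : Group G) (_ : Finite G) (g₁ : G →* L₁) (g₂ : G →* L₂),
      Function.Surjective g₁ ∧ Function.Surjective g₂ ∧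
        Nonempty (R₁.comap g₁ ≃* R₂.comap g₂) := by
  induction n with
  | zero =>
    intro P _ _ _ H₁ H₂ _ _ _ _ h₁ h₂ L₁ L₂ _ _ _ _ f₁ f₂ hf₁ hf₂ R₁ R₂ hR₁ hR₂ eN eR
    obtain ⟨e₁⟩ := h₁
    obtain ⟨e₂⟩ := h₂
    let k₁ : L₁ →* P 0 := e₁.toMonoidHom.comp f₁
    let k₂ : L₂ →* P 0 := e₂.toMonoidHom.comp f₂
    have hk₁ : k₁.ker = f₁.ker := ker_mulEquiv_comp f₁ e₁
    have hk₂ : k₂.ker = f₂.ker := ker_mulEquiv_comp f₂ e₂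
    have sk₁ : Function.Surjective k₁ := e₁.surjective.comp hf₁
    have sk₂ : Function.Surjective k₂ := e₂.surjective.comp hf₂
    let G : Subgroup (L₁ × L₂) :=
      (k₁.comp (MonoidHom.fst L₁ L₂)).eqLocus (k₂.comp (MonoidHom.snd L₁ L₂))
    refine ⟨G, inferInstance, inferInstance, (MonoidHom.fst L₁ L₂).comp G.subtype,
      (MonoidHom.snd L₁ L₂).comp G.subtype, fun a => ?_, fun b => ?_,
      nonempty_comap_fiberProduct_equiv k₁ k₂ (hk₁ ▸ hR₁) (hk₂ ▸ hR₂)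
        ((MulEquiv.subgroupCongr hk₁).trans (eN.trans (MulEquiv.subgroupCongr hk₂.symm))) eR G
        fun _ => Iff.rfl⟩
    · obtain ⟨b, hb⟩ := sk₂ (k₁ a)
      exact ⟨⟨(a, b), hb.symm⟩, rfl⟩
    · obtain ⟨a, ha⟩ := sk₁ (k₂ b)
      exact ⟨⟨(a, b), ha⟩, rfl⟩
  | succ n ih =>
    intro P _ _ hP H₁ H₂ _ _ _ _ h₁ h₂ L₁ L₂ _ _ _ _ f₁ f₂ hf₁ hf₂ R₁ R₂ hR₁ hR₂ eN eR
    obtain ⟨Q₁, _, φ₁, hQ₁, ⟨e₁⟩⟩ := h₁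
    obtain ⟨Q₂, _, φ₂, hQ₂, ⟨e₂⟩⟩ := h₂
    have : Finite (P 0 ⋊[φ₁] Q₁) := Finite.of_equiv _ e₁.toEquiv
    have : Finite (P 0 ⋊[φ₂] Q₂) := Finite.of_equiv _ e₂.toEquiv
    have : Finite Q₁ := Finite.of_surjective _ (SemidirectProduct.rightHom_surjective (φ := φ₁))
    have : Finite Q₂ := Finite.of_surjective _ (SemidirectProduct.rightHom_surjective (φ := φ₂))
    have : Finite (MulAut (P 0)) := Finite.of_injective _ MulEquiv.toEquiv_injective
    have : Finite ((MulAut (P 0) → L₂) ⋊[mulAutArrow] MulAut (P 0)) :=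
      Finite.of_equiv _ SemidirectProduct.equivProd.symm
    have : Finite ((MulAut (P 0) → L₁) ⋊[mulAutArrow] MulAut (P 0)) :=
      Finite.of_equiv _ SemidirectProduct.equivProd.symm
    let k₁ : L₁ →* P 0 ⋊[φ₁] Q₁ := e₁.toMonoidHom.comp f₁
    let k₂ : L₂ →* P 0 ⋊[φ₂] Q₂ := e₂.toMonoidHom.comp f₂
    have hk₁ : k₁.ker = f₁.ker := ker_mulEquiv_comp f₁ e₁
    have hk₂ : k₂.ker = f₂.ker := ker_mulEquiv_comp f₂ e₂
    have sk₁ : Function.Surjective k₁ := e₁.surjective.comp hf₁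
    have sk₂ : Function.Surjective k₂ := e₂.surjective.comp hf₂
    have hR₁' : R₁ ≤ k₁.ker := hk₁ ▸ hR₁
    have hR₂' : R₂ ≤ k₂.ker := hk₂ ▸ hR₂
    have eN' : k₁.ker ≃* k₂.ker :=
      (MulEquiv.subgroupCongr hk₁).trans (eN.trans (MulEquiv.subgroupCongr hk₂.symm))
    obtain ⟨G, _, _, g₁, g₂, hg₁, hg₂, e⟩ := ih (fun i => P i.succ) (fun i => hP i.succ) hQ₁ hQ₂
      (twistedCover.proj (hP 0) k₁ k₂) (twistedCover.proj (hP 0) k₂ k₁)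
      (twistedCover.proj_surjective (hP 0) k₁ k₂ sk₁ sk₂)
      (twistedCover.proj_surjective (hP 0) k₂ k₁ sk₂ sk₁)
      (R₁.comap (twistedCover.eval (hP 0) k₁ k₂)) (R₂.comap (twistedCover.eval (hP 0) k₂ k₁))
      (twistedCover.comap_eval_le_ker_proj (hP 0) k₁ k₂ hR₁')
      (twistedCover.comap_eval_le_ker_proj (hP 0) k₂ k₁ hR₂')
      (twistedCover.kerEquiv (hP 0) k₁ k₂)
      (twistedCover.nonempty_comap_eval_equiv (hP 0) k₁ k₂ hR₁' hR₂' eN' eR).some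
    exact ⟨G, inferInstance, inferInstance, (twistedCover.eval (hP 0) k₁ k₂).comp g₁,
      (twistedCover.eval (hP 0) k₂ k₁).comp g₂,
      (twistedCover.eval_surjective (hP 0) k₁ k₂ sk₁ sk₂).comp hg₁,
      (twistedCover.eval_surjective (hP 0) k₂ k₁ sk₂ sk₁).comp hg₂, e⟩

/-! ### From a common cover to compatibility -/

/-- Compatibility may be witnessed by a finite group in any universe and a pair of surjections with
isomorphic kernels. -/
theorem Compatible.of_surjective {L₁ : Type u} {L₂ : Type v} [Group L₁] [Group L₂] {G : Type w}
    [Group G] [Finite G] (g₁ : G →* L₁) (g₂ : G →* L₂) (hg₁ : Function.Surjective g₁)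
    (hg₂ : Function.Surjective g₂) (e : g₁.ker ≃* g₂.ker) : Compatible L₁ L₂ := by
  let s : Shrink.{0} G ≃* G := Shrink.mulEquiv
  let k₁ : Shrink.{0} G →* L₁ := g₁.comp s.toMonoidHom
  let k₂ : Shrink.{0} G →* L₂ := g₂.comp s.toMonoidHom
  have e₁ : k₁.ker ≃* g₁.ker := s.subgroupMap k₁.ker |>.trans <| MulEquiv.subgroupCongr <| by
    ext x
    simp [k₁, MonoidHom.mem_ker]
  have e₂ : k₂.ker ≃* g₂.ker := s.subgroupMap k₂.ker |>.trans <| MulEquiv.subgroupCongr <| by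
    ext x
    simp [k₂, MonoidHom.mem_ker]
  exact ⟨Shrink.{0} G, inferInstance, Finite.of_equiv _ s.symm.toEquiv, k₁.ker, k₂.ker,
    inferInstance, inferInstance, ⟨e₁.trans (e.trans e₂.symm)⟩,
    ⟨(QuotientGroup.quotientKerEquivOfSurjective k₁ (hg₁.comp s.surjective)).symm⟩,
    ⟨(QuotientGroup.quotientKerEquivOfSurjective k₂ (hg₂.comp s.surjective)).symm⟩⟩

theorem mainTheorem5 (n : ℕ) (P : Fin (n + 1) → Type w) [∀ i, Group (P i)] [∀ i, Finite (P i)]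
    (hP : ∀ i, ∀ σ τ : MulAut (P i), σ * τ = τ * σ)
    (L₁ : Type u) (L₂ : Type v) [Group L₁] [Group L₂] [Finite L₁] [Finite L₂]
    (hcard : Nat.card L₁ = Nat.card L₂)
    (N₁ : Subgroup L₁) (N₂ : Subgroup L₂) [N₁.Normal] [N₂.Normal]
    (hN : Nonempty (N₁ ≃* N₂))
    (h₁ : IsIteratedSemidirectProduct n P (L₁ ⧸ N₁))
    (h₂ : IsIteratedSemidirectProduct n P (L₂ ⧸ N₂)) :
    Compatible L₁ L₂ := by
  obtain ⟨ν⟩ := hN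
  let u₁ : ULift.{max v w} L₁ ≃* L₁ := MulEquiv.ulift
  let u₂ : ULift.{max u w} L₂ ≃* L₂ := MulEquiv.ulift
  let f₁ : ULift.{max v w} L₁ →* L₁ ⧸ N₁ := (QuotientGroup.mk' N₁).comp u₁.toMonoidHom
  let f₂ : ULift.{max u w} L₂ →* L₂ ⧸ N₂ := (QuotientGroup.mk' N₂).comp u₂.toMonoidHom
  have e₁ : f₁.ker ≃* N₁ := u₁.subgroupMap f₁.ker |>.trans <| MulEquiv.subgroupCongr <| by
    ext x
    simp [f₁]
  have e₂ : f₂.ker ≃* N₂ := u₂.subgroupMap f₂.ker |>.trans <| MulEquiv.subgroupCongr <| by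
    ext x
    simp [f₂]
  -- Starting from trivial subgroups, the preimages in the common cover are the kernels of `g₁` and
  -- `g₂`.
  have eR : (⊥ : Subgroup (ULift.{max v w} L₁)) ≃* (⊥ : Subgroup (ULift.{max u w} L₂)) :=
    MulEquiv.ofUnique
  obtain ⟨G, _, _, g₁, g₂, hg₁, hg₂, ⟨e⟩⟩ := exists_common_cover.{u, v, w} n P hP h₁ h₂ f₁ f₂
    ((QuotientGroup.mk'_surjective N₁).comp u₁.surjective)
    ((QuotientGroup.mk'_surjective N₂).comp u₂.surjective) ⊥ ⊥ bot_le bot_le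
    (e₁.trans (ν.trans e₂.symm)) eR
  exact Compatible.of_surjective (u₁.toMonoidHom.comp g₁) (u₂.toMonoidHom.comp g₂)
    (u₁.surjective.comp hg₁) (u₂.surjective.comp hg₂)
    ((MulEquiv.subgroupCongr (ker_mulEquiv_comp g₁ u₁)).trans
      (e.trans (MulEquiv.subgroupCongr (ker_mulEquiv_comp g₂ u₂)).symm))
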